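/- A set $\mathcal A$ of infinite subsets of $\omega$ is an almost disjoint family if $\mathcal A$ is infinite and any two distinct elements of $\mathcal A$ have finite intersection; it is a mad family if it is maximal with respect to inclusion among almost disjoint families. For such $\mathcal A$ let $\mathcal I(\mathcal A)$ be the ideal of all $I\subseteq\omega$ for which there is a finite $\mathcal B\subseteq\mathcal A$ with $I\setminus\bigcup\mathcal B$ finite, and let $\mathcal F(\mathcal A)=\{\omega\setminus I: I\in\mathcal I(\mathcal A)\}$ be the dual filter. For a filter $\mathcal F$ on $\omega$, the Mathias forcing $\mathbb M_{\mathcal F}$ consists of all pairs $\langle s,F\rangle$ with $s\subseteq\omega$ finite, $F\in\mathcal F$ and $\max s<\min F$, where $\langle s,F\rangle$ is stronger than $\langle t,G\rangle$ if $F\subseteq G$, $s$ is an end-extension of $t$, and $s\setminus t\subseteq G$. A forcing notion adds a dominating real if it is forced, by every condition, that there is $x\in\omega^\omega$ such that for every $a\in\omega^\omega$ in the ground model, $a(n)\le x(n)$ for all but finitely many $n$. **Proposition.** There exists a mad family $\mathcal A$ on $\omega$ such that $\mathbb M_{\mathcal F(\mathcal A)}$ adds a dominating real. -/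

import Mathlib

/-! ### Almost disjoint families on `ω` and their ideals and filters -/

/-- An almost disjoint family on `ω`: an infinite set of infinite subsets of `ω`, any two
distinct elements of which have finite intersection. -/
structure IsAlmostDisjointFamily (A : Set (Set ℕ)) : Prop where
  infinite : A.Infinite
  infinite_of_mem : ∀ a ∈ A, a.Infinite
  finite_inter : ∀ a ∈ A, ∀ b ∈ A, a ≠ b → (a ∩ b).Finite

/-- A mad family on `ω`: an almost disjoint family that is maximal with respect to inclusion
among all almost disjoint families. -/
def IsMadFamily (A : Set (Set ℕ)) : Prop :=
  Maximal IsAlmostDisjointFamily A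

/-- The ideal `I(A)`: the sets `I ⊆ ω` that are contained, up to a finite set, in the union of
finitely many elements of `A`. -/
def idealOf (A : Set (Set ℕ)) : Set (Set ℕ) :=
  {I | ∃ B : Set (Set ℕ), B ⊆ A ∧ B.Finite ∧ (I \ ⋃₀ B).Finite}

/-- The filter `F(A)` dual to `I(A)`: `X ∈ F(A)` if and only if `ω \ X ∈ I(A)`. -/
def filterOf (A : Set (Set ℕ)) : Filter ℕ :=
  Filter.comk (fun I => I ∈ idealOf A)
    ⟨∅, Set.empty_subset A, Set.finite_empty, by simp⟩
    (fun _ ⟨B, hBA, hB, h⟩ _ hst => ⟨B, hBA, hB, h.subset (Set.sdiff_subset_sdiff_left hst)⟩)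
    (fun s ⟨B, hBA, hB, h⟩ t ⟨C, hCA, hC, k⟩ =>
      ⟨B ∪ C, Set.union_subset hBA hCA, hB.union hC, (h.union k).subset (by
        rw [Set.sUnion_union]
        rintro x ⟨hx | hx, hn⟩
        · exact Or.inl ⟨hx, fun hb => hn (Or.inl hb)⟩
        · exact Or.inr ⟨hx, fun hc => hn (Or.inr hc)⟩)⟩)

/-! ### Mathias forcing associated with a filter -/

/-- The conditions of the Mathias forcing `M_F`: pairs `⟨s, X⟩` with `s ⊆ ω` finite, `X ∈ F` and
`max s < min X`. -/
structure MathiasForcing (F : Filter ℕ) where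
  stem : Finset ℕ
  side : Set ℕ
  side_mem : side ∈ F
  stem_lt_side : ∀ i ∈ stem, ∀ j ∈ side, i < j

/-- `⟨s, X⟩` is stronger than `⟨t, Y⟩` (written `⟨s, X⟩ ≤ ⟨t, Y⟩`) if `X ⊆ Y`, `s` is an
end-extension of `t`, and `s \ t ⊆ Y`. -/
instance MathiasForcing.instPreorder (F : Filter ℕ) : Preorder (MathiasForcing F) where
  le p q :=
    p.side ⊆ q.side ∧
    (q.stem ⊆ p.stem ∧ ∀ i ∈ q.stem, ∀ j ∈ p.stem, j ∉ q.stem → i < j) ∧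
    ∀ j ∈ p.stem, j ∉ q.stem → j ∈ q.side
  le_refl p :=
    ⟨subset_rfl, ⟨subset_rfl, fun _ _ _ hj hn => absurd hj hn⟩, fun _ hj hn => absurd hj hn⟩
  le_trans p q r hpq hqr := by
    obtain ⟨h1, ⟨h2, h3⟩, h4⟩ := hpq
    obtain ⟨k1, ⟨k2, k3⟩, k4⟩ := hqr
    refine ⟨h1.trans k1, ⟨k2.trans h2, fun i hi j hj hjr => ?_⟩, fun j hj hjr => ?_⟩
    · by_cases hjq : j ∈ q.stem
      · exact k3 i hi j hjq hjr
      · exact h3 i (k2 hi) j hj hjq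
    · by_cases hjq : j ∈ q.stem
      · exact k4 j hjq hjr
      · exact k1 (h4 j hj hjq)

/-! ### Forcing

`P` is a forcing notion, and `q ≤ p` means that `q` is stronger than `p`.  A sentence `φ` of the
forcing language is represented by the predicate `p ↦ (p ⊩ φ)` on conditions; the definitions
below are the usual recursive clauses of the forcing relation.  -/

/-- A sentence of the forcing language, represented by the relation `p ⊩ φ`. -/
abbrev ForcingSentence (P : Type) : Type := P → Prop

namespace ForcingSentence

variable {P : Type} [Preorder P]

/-- `p ⊩ φ ∧ ψ` iff `p ⊩ φ` and `p ⊩ ψ`. -/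
def and (φ ψ : ForcingSentence P) : ForcingSentence P :=
  fun p => φ p ∧ ψ p

/-- `p ⊩ ¬ φ` iff no `q ≤ p` forces `φ`. -/
def neg (φ : ForcingSentence P) : ForcingSentence P :=
  fun p => ∀ q ≤ p, ¬ φ q

/-- Quantification over (the canonical names of) the elements `i` of a ground model set:
`p ⊩ ∀ i, φ i` iff `p ⊩ φ i` for all `i`. -/
def all {ι : Type} (φ : ι → ForcingSentence P) : ForcingSentence P :=
  fun p => ∀ i, φ i p

/-- Quantification over (the canonical names of) the elements `i` of a ground model set:
`p ⊩ ∃ i, φ i` iff the set of all `r` that force some `φ i` is dense below `p`. -/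
def ex {ι : Type} (φ : ι → ForcingSentence P) : ForcingSentence P :=
  fun p => ∀ q ≤ p, ∃ r ≤ q, ∃ i, φ i r

end ForcingSentence

/-- A `P`-name for a subset of `ω × ω`.  The name `τ` consists of the pairs `⟨(n, k)ˇ, c⟩` with
`c ∈ τ n k`; in the extension by a generic filter `G` it is evaluated to the set of all `(n, k)`
such that `τ n k ∩ G ≠ ∅`.  Every subset of `ω × ω` in a generic extension has such a name. -/
def RelName (P : Type) : Type := ℕ → ℕ → Set P

namespace RelName

variable {P : Type} [Preorder P]

/-- `p ⊩ (n, k) ∈ τ` iff the set of all `r` that are below some `c` with `⟨(n, k)ˇ, c⟩ ∈ τ` is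
dense below `p`. -/
def mem (τ : RelName P) (n k : ℕ) : ForcingSentence P :=
  fun p => ∀ q ≤ p, ∃ r ≤ q, ∃ c ∈ τ n k, r ≤ c

/-- The sentence "`τ` is (the graph of) a function from `ω` to `ω`": for every `n` there is `k`
with `(n, k) ∈ τ`, and there are no `k ≠ l` with `(n, k) ∈ τ` and `(n, l) ∈ τ`. -/
def isFunction (τ : RelName P) : ForcingSentence P :=
  ForcingSentence.all fun n : ℕ =>
    ForcingSentence.and
      (ForcingSentence.ex fun k : ℕ => τ.mem n k)
      (ForcingSentence.neg
        (ForcingSentence.ex fun kl : {kl : ℕ × ℕ // kl.1 ≠ kl.2} =>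
          ForcingSentence.and (τ.mem n kl.1.1) (τ.mem n kl.1.2)))

/-- The sentence "`a(n) ≤ τ(n)` for all but finitely many `n`", for a ground model function `a`:
there is `N` such that for all `n ≥ N` there is `k ≥ a(n)` with `(n, k) ∈ τ`. -/
def eventuallyDominates (τ : RelName P) (a : ℕ → ℕ) : ForcingSentence P :=
  ForcingSentence.ex fun N : ℕ =>
    ForcingSentence.all fun n : {n : ℕ // N ≤ n} =>
      ForcingSentence.ex fun k : {k : ℕ // a n.1 ≤ k} => τ.mem n.1 k.1

end RelName

/-- The forcing notion `P` adds a dominating real: there is a name `τ` such that it is forced (by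
every condition) that `τ` is an element of `ω^ω` and that, for every `a ∈ ω^ω` of the ground model,
`a(n) ≤ τ(n)` for all but finitely many `n`. -/
def AddsDominatingReal (P : Type) [Preorder P] : Prop :=
  ∃ τ : RelName P, ∀ p : P, τ.isFunction p ∧ ∀ a : ℕ → ℕ, τ.eventuallyDominates a p

/-! ### Extending almost disjoint families to mad families -/

/-! Code the nodes of `ω^{<ω}` by integers. Branch sets and pieces of fans form an almost disjoint
family; extend it to a mad family. Then branch sets lie in the ideal, so the generic set `G` almost
avoids each ground model `branchSet x`. Each fan contains infinitely many members of the family,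
hence is positive, so `G` meets it infinitely often; this is why fans are split into pieces. If
`branchSet x` misses `G` from `n` on, then at each node of `x` the next value of `x` is less than
any `i` whose code there is in `G` and at least `n`. By induction on levels, finitely many nodes
remain at each level, so all such `x` have a common bound at argument `n`. Mapping `n` to this bound
dominates every ground model `x`. -/

/-- Every almost disjoint family is contained in a mad family. -/
theorem IsAlmostDisjointFamily.exists_isMadFamily {A : Set (Set ℕ)}
    (hA : IsAlmostDisjointFamily A) : ∃ M, A ⊆ M ∧ IsMadFamily M := by
  refine zorn_subset_nonempty {B | IsAlmostDisjointFamily B} ?_ A hA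
  -- A nonempty chain is needed for its union to be infinite.
  intro c hc hchain ⟨B, hB⟩
  refine ⟨⋃₀ c, ⟨(hc hB).infinite.mono (Set.subset_sUnion_of_mem hB), ?_, ?_⟩,
    fun s hs => Set.subset_sUnion_of_mem hs⟩
  · rintro a ⟨C, hC, ha⟩
    exact (hc hC).infinite_of_mem a ha
  · rintro a ⟨C, hC, ha⟩ b ⟨D, hD, hb⟩ hab
    rcases hchain.total hC hD with h | h
    · exact (hc hD).finite_inter a (h ha) b hb hab
    · exact (hc hC).finite_inter a ha b (h hb) hab

theorem mem_filterOf {A : Set (Set ℕ)} {X : Set ℕ} : X ∈ filterOf A ↔ Xᶜ ∈ idealOf A :=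
  Iff.rfl

theorem compl_mem_filterOf_of_mem {A : Set (Set ℕ)} {a : Set ℕ} (ha : a ∈ A) :
    aᶜ ∈ filterOf A := by
  rw [mem_filterOf, compl_compl]
  exact ⟨{a}, by simpa using ha, Set.finite_singleton a, by simp⟩

theorem compl_mem_filterOf_of_finite {A : Set (Set ℕ)} {a : Set ℕ} (ha : a.Finite) :
    aᶜ ∈ filterOf A := by
  rw [mem_filterOf, compl_compl]
  exact ⟨∅, Set.empty_subset A, Set.finite_empty, by simpa using ha⟩

theorem Ioi_mem_filterOf (A : Set (Set ℕ)) (m : ℕ) : Set.Ioi m ∈ filterOf A := by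
  simpa using compl_mem_filterOf_of_finite (A := A) (Set.finite_Iic m)

/-- A set that contains infinitely many members of an almost disjoint family `A` meets every
element of `F(A)` in an infinite set. -/
theorem IsAlmostDisjointFamily.infinite_inter_of_mem_filterOf {A : Set (Set ℕ)}
    (hA : IsAlmostDisjointFamily A) {Y : Set ℕ} (hY : {a ∈ A | a ⊆ Y}.Infinite) {X : Set ℕ}
    (hX : X ∈ filterOf A) : (X ∩ Y).Infinite := by
  obtain ⟨B, hBA, hB, hfin⟩ := mem_filterOf.1 hX
  -- As `a ∉ B`, almost all of `a` avoids `⋃₀ B` and so lies in `X`.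
  obtain ⟨a, ⟨haA, haY⟩, haB⟩ := hY.exists_notMem_finite hB
  have hinter : (a ∩ ⋃₀ B).Finite := by
    rw [Set.sUnion_eq_biUnion, Set.inter_iUnion₂]
    exact hB.biUnion fun b hb => hA.finite_inter a haA b (hBA hb) fun h => haB (h ▸ hb)
  refine fun h => hA.infinite_of_mem a haA (((h.union hinter).union hfin).subset fun i hi => ?_)
  by_cases h1 : i ∈ X
  · exact Or.inl (Or.inl ⟨h1, haY hi⟩)
  · by_cases h2 : i ∈ ⋃₀ B
    · exact Or.inl (Or.inr ⟨hi, h2⟩)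
    · exact Or.inr ⟨h1, h2⟩

/-! ### An almost disjoint family indexed by the Baire space -/

/-- The initial segment of length `j` of `x`. -/
def initSeg (x : ℕ → ℕ) (j : ℕ) : List ℕ :=
  (List.range j).map x

theorem length_initSeg (x : ℕ → ℕ) (j : ℕ) : (initSeg x j).length = j := by
  simp [initSeg]

theorem eq_of_initSeg_eq {x y : ℕ → ℕ} {j k n : ℕ} (h : initSeg x j = initSeg y k)
    (hn : n < j) : x n = y n := by
  obtain rfl : j = k := by simpa [length_initSeg] using congrArg List.length h
  have := (List.map_inj_left.1 h) n (List.mem_range.2 hn)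
  exact this

/-- The natural number coding the immediate successor `σ ⌢ i` of the node `σ` of `ω^{<ω}`. -/
def nodeCode (σ : List ℕ) (i : ℕ) : ℕ :=
  Encodable.encode (σ, i)

theorem nodeCode_inj {σ τ : List ℕ} {i j : ℕ} : nodeCode σ i = nodeCode τ j ↔ σ = τ ∧ i = j := by
  simp only [nodeCode, Encodable.encode_inj, Prod.mk.injEq]

/-- The nodes that are on the branch `x` of `ω^{<ω}` or to the left of it with the same
immediate predecessor as a node of the branch. -/
def branchSet (x : ℕ → ℕ) : Set ℕ :=
  {m | ∃ j, ∃ i ≤ x j, m = nodeCode (initSeg x j) i}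

/-- The `k`-th piece of a partition of the set of immediate successors of `σ` into infinitely many
infinite sets. -/
def fanPiece (σ : List ℕ) (k : ℕ) : Set ℕ :=
  Set.range fun j => nodeCode σ (Nat.pair k j)

theorem infinite_branchSet (x : ℕ → ℕ) : (branchSet x).Infinite := by
  refine (Set.infinite_range_of_injective (f := fun j => nodeCode (initSeg x j) 0) ?_).mono ?_
  · intro j k h
    simpa [length_initSeg] using congrArg List.length (nodeCode_inj.1 h).1
  · rintro _ ⟨j, rfl⟩
    exact ⟨j, 0, Nat.zero_le _, rfl⟩

theorem infinite_fanPiece (σ : List ℕ) (k : ℕ) : (fanPiece σ k).Infinite := by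
  refine Set.infinite_range_of_injective fun i j h => ?_
  simpa using (nodeCode_inj.1 h).2

/-- Common codes have their node on both branches, hence at a level at most any `n` where `x` and
`y` differ; each level contributes finitely many. -/
theorem finite_branchSet_inter_branchSet {x y : ℕ → ℕ} (h : x ≠ y) :
    (branchSet x ∩ branchSet y).Finite := by
  obtain ⟨n, hn⟩ := Function.ne_iff.1 h
  refine ((Set.finite_Iic n).biUnion fun j _ =>
    (Set.finite_Iic (x j)).image (nodeCode (initSeg x j))).subset ?_
  rintro _ ⟨⟨j, i, hi, rfl⟩, k, l, -, hkl⟩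
  refine Set.mem_biUnion (x := j) ?_ ⟨i, hi, rfl⟩
  exact not_lt.1 fun hlt => hn (eq_of_initSeg_eq (nodeCode_inj.1 hkl).1 hlt)

/-- The fan of `σ` meets a branch set only at level `σ.length`, in codes with `i ≤ x σ.length`. -/
theorem finite_branchSet_inter_fanPiece (x : ℕ → ℕ) (σ : List ℕ) (k : ℕ) :
    (branchSet x ∩ fanPiece σ k).Finite := by
  refine ((Set.finite_Iic (x σ.length)).image (nodeCode σ)).subset ?_
  rintro _ ⟨⟨j, i, hi, rfl⟩, l, hl⟩
  obtain ⟨rfl, -⟩ := nodeCode_inj.1 hl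
  exact ⟨i, by simpa [length_initSeg] using hi, rfl⟩

theorem eq_of_mem_fanPiece {σ τ : List ℕ} {k l m : ℕ} (h : m ∈ fanPiece σ k)
    (h' : m ∈ fanPiece τ l) : σ = τ ∧ k = l := by
  obtain ⟨i, rfl⟩ := h
  obtain ⟨j, hj⟩ := h'
  obtain ⟨rfl, h⟩ := nodeCode_inj.1 hj
  exact ⟨rfl, (Nat.pair_eq_pair.1 h).1.symm⟩

theorem fanPiece_injective (σ : List ℕ) : Function.Injective (fanPiece σ) := by
  intro k l h
  obtain ⟨m, hm⟩ := (infinite_fanPiece σ k).nonempty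
  exact (eq_of_mem_fanPiece hm (h ▸ hm)).2

/-- The family of all branch sets and all pieces of fans. -/
def branchFamily : Set (Set ℕ) :=
  Set.range branchSet ∪ {a | ∃ σ k, a = fanPiece σ k}

theorem isAlmostDisjointFamily_branchFamily : IsAlmostDisjointFamily branchFamily where
  infinite := (Set.infinite_range_of_injective (fanPiece_injective [])).mono <| by
    rintro _ ⟨k, rfl⟩
    exact Or.inr ⟨[], k, rfl⟩
  infinite_of_mem := by
    rintro _ (⟨x, rfl⟩ | ⟨σ, k, rfl⟩)
    · exact infinite_branchSet x
    · exact infinite_fanPiece σ k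
  finite_inter := by
    rintro _ (⟨x, rfl⟩ | ⟨σ, k, rfl⟩) _ (⟨y, rfl⟩ | ⟨τ, l, rfl⟩) hab
    · exact finite_branchSet_inter_branchSet fun h => hab (h ▸ rfl)
    · exact finite_branchSet_inter_fanPiece x τ l
    · rw [Set.inter_comm]
      exact finite_branchSet_inter_fanPiece y σ k
    · refine Set.finite_empty.subset ?_
      rintro m ⟨h, h'⟩
      obtain ⟨rfl, rfl⟩ := eq_of_mem_fanPiece h h'
      exact hab rfl

/-! ### Extending Mathias conditions -/

namespace MathiasForcing

/-- Shrink the side of a condition. -/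
def restrict {F : Filter ℕ} (p : MathiasForcing F) (X : Set ℕ) (hX : X ∈ F) :
    MathiasForcing F where
  stem := p.stem
  side := p.side ∩ X
  side_mem := Filter.inter_mem p.side_mem hX
  stem_lt_side i hi j hj := p.stem_lt_side i hi j hj.1

theorem restrict_le {F : Filter ℕ} (p : MathiasForcing F) (X : Set ℕ) (hX : X ∈ F) :
    p.restrict X hX ≤ p :=
  ⟨Set.inter_subset_left, ⟨subset_rfl, fun _ _ _ hj hn => absurd hj hn⟩,
    fun _ hj hn => absurd hj hn⟩

theorem exists_le_mem_stem {F : Filter ℕ} (p : MathiasForcing F) {i : ℕ} (hi : i ∈ p.side)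
    (hF : Set.Ioi i ∈ F) : ∃ q ≤ p, i ∈ q.stem := by
  classical
  refine ⟨⟨insert i p.stem, p.side ∩ Set.Ioi i, Filter.inter_mem p.side_mem hF, ?_⟩,
    ⟨Set.inter_subset_left, ⟨Finset.subset_insert _ _, ?_⟩, ?_⟩, Finset.mem_insert_self _ _⟩
  · intro a ha b hb
    rcases Finset.mem_insert.1 ha with rfl | ha
    · exact hb.2
    · exact p.stem_lt_side a ha b hb.1
  · intro a ha b hb hn
    rcases Finset.mem_insert.1 hb with rfl | hb
    · exact p.stem_lt_side a ha b hi
    · exact absurd hb hn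
  · intro b hb hn
    rcases Finset.mem_insert.1 hb with rfl | hb
    · exact hi
    · exact absurd hb hn

theorem stem_subset_of_le {F : Filter ℕ} {p q : MathiasForcing F} (h : p ≤ q) :
    q.stem ⊆ p.stem :=
  h.2.1.1

theorem mem_side_of_le {F : Filter ℕ} {p q : MathiasForcing F} (h : p ≤ q) {i : ℕ}
    (hp : i ∈ p.stem) (hq : i ∉ q.stem) : i ∈ q.side :=
  h.2.2 i hp hq

/-- If all fans are `F`-positive, a condition can be extended so that its stem contains large
successors of finitely many given nodes. -/
theorem exists_le_forall_nodeCode_mem {F : Filter ℕ} (hF : ∀ m, Set.Ioi m ∈ F)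
    (hfan : ∀ σ, ∀ X ∈ F, (X ∩ Set.range (nodeCode σ)).Infinite) (n : ℕ)
    (S : Finset (List ℕ)) (p : MathiasForcing F) :
    ∃ q ≤ p, ∀ σ ∈ S, ∃ i, nodeCode σ i ∈ q.stem ∧ n ≤ nodeCode σ i := by
  classical
  induction S using Finset.induction_on with
  | empty => exact ⟨p, le_rfl, by simp⟩
  | insert σ S _ ih =>
    obtain ⟨q, hqp, hq⟩ := ih
    obtain ⟨_, ⟨hside, i, rfl⟩, hn⟩ := (hfan σ q.side q.side_mem).exists_gt n
    obtain ⟨r, hrq, hr⟩ := q.exists_le_mem_stem hside (hF _)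
    refine ⟨r, hrq.trans hqp, fun τ hτ => ?_⟩
    rcases Finset.mem_insert.1 hτ with rfl | hτ
    · exact ⟨i, hr, hn.le⟩
    · obtain ⟨k, hk, hk'⟩ := hq τ hτ
      exact ⟨k, stem_subset_of_le hrq hk, hk'⟩

end MathiasForcing

theorem finite_initSeg_of_lt (l m : ℕ) : {σ | ∃ x : ℕ → ℕ, (∀ j < l, x j < m) ∧
    σ = initSeg x l}.Finite := by
  refine (Set.finite_range fun g : Fin l → Fin m => List.ofFn fun j => (g j : ℕ)).subset ?_
  rintro _ ⟨x, hx, rfl⟩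
  refine ⟨fun j => ⟨x j, hx j j.2⟩, ?_⟩
  refine List.ext_getElem (by simp [initSeg]) fun i _ _ => by simp [initSeg]

/-! ### The dominating real -/

/-- Below level `l`, the branch set of `x` contains no code in `G` that is at least `n`. -/
def AvoidsBelow (G : Set ℕ) (n l : ℕ) (x : ℕ → ℕ) : Prop :=
  ∀ j < l, ∀ i ≤ x j, nodeCode (initSeg x j) i ∈ G → nodeCode (initSeg x j) i < n

theorem AvoidsBelow.anti {G H : Set ℕ} {n l k : ℕ} {x : ℕ → ℕ} (h : AvoidsBelow H n l x)
    (hGH : G ⊆ H) (hk : k ≤ l) : AvoidsBelow G n k x :=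
  fun j hj i hi hG => h j (hj.trans_le hk) i hi (hGH hG)

/-- `m` bounds the `n`-th value of every `x` whose branch set contains no code in `G` that is at
least `n`, and this is witnessed by `G ∩ m`. -/
def IsBoundAt (G : Set ℕ) (n m : ℕ) : Prop :=
  ∀ x, AvoidsBelow (G ∩ Set.Iio m) n (n + 1) x → x n < m

theorem MathiasForcing.exists_le_bound {F : Filter ℕ} (hF : ∀ m, Set.Ioi m ∈ F)
    (hfan : ∀ σ, ∀ X ∈ F, (X ∩ Set.range (nodeCode σ)).Infinite) (n l : ℕ)
    (p : MathiasForcing F) :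
    ∃ q ≤ p, ∃ m, ∀ x, AvoidsBelow q.stem n l x → ∀ j < l, x j < m := by
  induction l with
  | zero => exact ⟨p, le_rfl, 0, by simp⟩
  | succ l ih =>
    obtain ⟨q, hqp, m, hm⟩ := ih
    -- Only finitely many nodes of level `l` have entries below `m`; a successor code `≥ n` of each
    -- goes into the stem and caps the next value.
    obtain ⟨r, hrq, hr⟩ :=
      exists_le_forall_nodeCode_mem hF hfan n (finite_initSeg_of_lt l m).toFinset q
    choose! f hf hfn using hr
    refine ⟨r, hrq.trans hqp, m + (finite_initSeg_of_lt l m).toFinset.sup f, fun x hx j hj => ?_⟩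
    have hxm := hm x (hx.anti (stem_subset_of_le hrq) l.le_succ)
    rcases Nat.lt_succ_iff_lt_or_eq.1 hj with hj | rfl
    · exact (hxm j hj).trans_le (Nat.le_add_right _ _)
    · have hmem : initSeg x j ∈ (finite_initSeg_of_lt j m).toFinset := by
        simpa using ⟨x, hxm, rfl⟩
      have hlt : x j < f (initSeg x j) := by
        by_contra! hle
        exact (hfn _ hmem).not_gt (hx j j.lt_succ_self _ hle (hf _ hmem))
      exact (hlt.trans_le (Finset.le_sup hmem)).trans_le (Nat.le_add_left _ _)

/-- The name of the function that maps `n` to the least `m` with `IsBoundAt G n m`, where `G` is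
the generic set. -/
def boundName (F : Filter ℕ) : RelName (MathiasForcing F) :=
  fun n k => {c | IsLeast {m | IsBoundAt c.stem n m} k ∧ c.side ⊆ Set.Ici k}

/-- For `m ≤ k`, `IsBoundAt` sees only the stem below `k`, and extensions of `c` add only elements
`≥ k`. -/
theorem isLeast_of_le_mem_boundName {F : Filter ℕ} {r c : MathiasForcing F} {n k : ℕ}
    (hc : c ∈ boundName F n k) (hrc : r ≤ c) : IsLeast {m | IsBoundAt r.stem n m} k := by
  have heq : ∀ m ≤ k, IsBoundAt r.stem n m ↔ IsBoundAt c.stem n m := by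
    intro m hm
    have : (r.stem : Set ℕ) ∩ Set.Iio m = (c.stem : Set ℕ) ∩ Set.Iio m := by
      ext i
      refine and_congr_left fun hi => ⟨fun h => ?_, fun h => MathiasForcing.stem_subset_of_le hrc h⟩
      by_contra hn
      exact ((Set.mem_Iio.1 hi).trans_le hm).not_ge (hc.2 (MathiasForcing.mem_side_of_le hrc h hn))
    rw [IsBoundAt, IsBoundAt, this]
  refine ⟨(heq k le_rfl).2 hc.1.1, fun m hm => ?_⟩
  by_contra! hlt
  exact hlt.not_ge (hc.1.2 ((heq m hlt.le).1 hm))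

theorem mem_boundName_of_mem {F : Filter ℕ} {c : MathiasForcing F} {n k : ℕ}
    (hc : c ∈ boundName F n k) : (boundName F).mem n k c :=
  fun q hq => ⟨q, le_rfl, c, hc, hq⟩

theorem exists_le_mem_boundName {F : Filter ℕ} (hF : ∀ m, Set.Ioi m ∈ F)
    (hfan : ∀ σ, ∀ X ∈ F, (X ∩ Set.range (nodeCode σ)).Infinite) (n : ℕ)
    (p : MathiasForcing F) : ∃ q ≤ p, ∃ k, q ∈ boundName F n k := by
  classical
  obtain ⟨q, hqp, m, hm⟩ := p.exists_le_bound hF hfan n (n + 1)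
  -- `M` exceeds the whole stem, so cutting at `M` loses nothing; shrinking the side beyond `M` then
  -- freezes the least bound.
  obtain ⟨M, hmM, hM⟩ : ∃ M, m ≤ M ∧ ∀ i ∈ q.stem, i < M :=
    ⟨m + (q.stem.sup id + 1), Nat.le_add_right _ _, fun i hi =>
      (Nat.lt_succ_of_le (Finset.le_sup (f := id) hi)).trans_le (Nat.le_add_left _ _)⟩
  have hb : IsBoundAt q.stem n M := by
    rw [IsBoundAt, Set.inter_eq_left.2 (show (q.stem : Set ℕ) ⊆ Set.Iio M from hM)]
    exact fun x hx => (hm x hx n n.lt_succ_self).trans_le hmM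
  have hex : ∃ k, IsBoundAt q.stem n k := ⟨M, hb⟩
  refine ⟨q.restrict (Set.Ioi M) (hF M), (q.restrict_le _ _).trans hqp, Nat.find hex,
    ⟨Nat.find_spec hex, fun k hk => Nat.find_min' hex hk⟩, ?_⟩
  exact fun i hi => (Nat.find_min' hex hb).trans (le_of_lt hi.2)

/-- Mathias forcing with a filter for which all fans are positive and all branch sets are small adds
a dominating real. -/
theorem MathiasForcing.addsDominatingReal {F : Filter ℕ} (hF : ∀ m, Set.Ioi m ∈ F)
    (hfan : ∀ σ, ∀ X ∈ F, (X ∩ Set.range (nodeCode σ)).Infinite)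
    (hbranch : ∀ x, (branchSet x)ᶜ ∈ F) : AddsDominatingReal (MathiasForcing F) := by
  refine ⟨boundName F, fun p => ⟨fun n => ⟨fun q _ => ?_, fun q _ hex => ?_⟩, fun a q _ => ?_⟩⟩
  · obtain ⟨r, hrq, k, hr⟩ := exists_le_mem_boundName hF hfan n q
    exact ⟨r, hrq, k, mem_boundName_of_mem hr⟩
  · obtain ⟨r, -, ⟨⟨k, l⟩, hne⟩, hk, hl⟩ := hex q le_rfl
    -- A common extension of `c` and `d` would have two least bounds.
    obtain ⟨s, hsr, c, hc, hsc⟩ := hk r le_rfl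
    obtain ⟨t, hts, d, hd, htd⟩ := hl s hsr
    exact hne ((isLeast_of_le_mem_boundName hc (hts.trans hsc)).unique
      (isLeast_of_le_mem_boundName hd htd))
  · refine ⟨q.restrict _ (hbranch a), q.restrict_le _ _, q.stem.sup id + 1, ?_⟩
    rintro ⟨n, hn⟩ r hr
    obtain ⟨s, hsr, k, hs⟩ := exists_le_mem_boundName hF hfan n r
    refine ⟨s, hsr, ⟨k, (hs.1.1 a ?_).le⟩, mem_boundName_of_mem hs⟩
    rintro j - i hi ⟨hmem, -⟩
    by_cases hq : nodeCode (initSeg a j) i ∈ q.stem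
    · exact (Nat.lt_succ_of_le (Finset.le_sup (f := id) hq)).trans_le hn
    · exact absurd ⟨j, i, hi, rfl⟩ (mem_side_of_le (hsr.trans hr) hmem hq).2

theorem proposition3p1 :
    ∃ A : Set (Set ℕ), IsMadFamily A ∧ AddsDominatingReal (MathiasForcing (filterOf A)) := by
  obtain ⟨A, hsub, hA⟩ := isAlmostDisjointFamily_branchFamily.exists_isMadFamily
  refine ⟨A, hA, MathiasForcing.addsDominatingReal (Ioi_mem_filterOf A) (fun σ X hX => ?_)
    fun x => compl_mem_filterOf_of_mem (hsub (Or.inl ⟨x, rfl⟩))⟩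
  refine hA.prop.infinite_inter_of_mem_filterOf ?_ hX
  refine (Set.infinite_range_of_injective (fanPiece_injective σ)).mono ?_
  rintro _ ⟨k, rfl⟩
  refine ⟨hsub (Or.inr ⟨σ, k, rfl⟩), ?_⟩
  rintro _ ⟨j, rfl⟩
  exact ⟨_, rfl⟩
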